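/- Let $d\ge 1$ be an integer, let $p\in[1,\infty)$, and let $\nu\colon\mathbb{R}^d\to[0,\infty)$ be a measurable, radially symmetric function, $\nu(x)=\nu_0(|x|)$ for $x\neq0$, such that $$\int_{\mathbb{R}^d}\bigl(1\wedge|x|^p\bigr)\,\nu(x)\,dx<\infty .$$ Suppose that the radial profile $\nu_0$ is positive near zero and has lower Matuszewska index at zero strictly bigger than $-d-1$. Here the lower Matuszewska index of $\nu_0$ at zero is the supremum in $[-\infty,\infty]$ of all $a\in\mathbb{R}$ for which there are $A,R_0>0$ with $$\frac{\nu_0(r_2)}{\nu_0(r_1)}\ \ge\ A\left(\frac{r_2}{r_1}\right)^{a}\qquad\text{whenever } 0<r_1<r_2<R_0 .$$ For $r>0$ put $$h_p(r)=\int_{\mathbb{R}^d}\left(1\wedge\frac{|x|^p}{r^p}\right)\nu(x)\,dx ,$$ and for measurable $f\colon\mathbb{R}^d\to\mathbb{R}$ put $$\|f\|_{W_p^\nu}=\|f\|_{L^p(\mathbb{R}^d)}+\left(\int_{\mathbb{R}^d}\int_{\mathbb{R}^d}|f(x+h)-f(x)|^p\,dx\,\nu(h)\,dh\right)^{1/p},\qquad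 W_p^\nu=\{f:\|f\|_{W_p^\nu}<\infty\}.$$ Then there is a constant $c>0$, depending only on $d$, $p$ and $\nu$, such that for all $f\in W_p^\nu$ $$\int_{\mathbb{R}^d}|f(x)|^p\,h_p(|x|)\,dx\ \le\ c\,\|f\|_{W_p^\nu}^{\,p} .$$ -/

import Mathlib

open MeasureTheory
open scoped ENNReal NNReal

/-- The lower Matuszewska index at zero of a function `φ` on `(0, ∞)` which is positive near zero:
the supremum (in the extended reals) of all `a : ℝ` such that, for some `A, R₀ > 0`,
`φ r₂ / φ r₁ ≥ A * (r₂ / r₁) ^ a` whenever `0 < r₁ < r₂ < R₀`.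
Only the values of `φ` on `(0, ∞)` matter. -/
noncomputable def lowerMatuszewskaIndexAtZero (φ : ℝ → ℝ) : EReal :=
  sSup ((fun a : ℝ => (a : EReal)) '' {a : ℝ | ∃ A R₀ : ℝ, 0 < A ∧ 0 < R₀ ∧
    (∀ r : ℝ, 0 < r → r < R₀ → 0 < φ r) ∧
    ∀ r₁ r₂ : ℝ, 0 < r₁ → r₁ < r₂ → r₂ < R₀ → A * (r₂ / r₁) ^ a ≤ φ r₂ / φ r₁})

/-- The measure `ν(dx) = ν(x) dx` on `ℝᵈ` with density `ν` (assumed non-negative where used). -/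
noncomputable def densityMeasure {d : ℕ} (ν : EuclideanSpace ℝ (Fin d) → ℝ) :
    Measure (EuclideanSpace ℝ (Fin d)) :=
  volume.withDensity (fun x => ENNReal.ofReal (ν x))

/-- The standing integrability condition `∫ (1 ∧ |x|ᵖ) μ(dx) < ∞`. -/
def IsPIntegrable {d : ℕ} (p : ℝ) (μ : Measure (EuclideanSpace ℝ (Fin d))) : Prop :=
  ∫⁻ x, ENNReal.ofReal (min 1 (‖x‖ ^ p)) ∂μ < ∞

/-- The concentration function `h_p(r) = ∫ (1 ∧ |x|ᵖ / rᵖ) μ(dx)`, for `r > 0`. -/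
noncomputable def concentration {d : ℕ} (p : ℝ) (μ : Measure (EuclideanSpace ℝ (Fin d)))
    (r : ℝ) : ℝ≥0∞ :=
  ∫⁻ x, ENNReal.ofReal (min 1 (‖x‖ ^ p / r ^ p)) ∂μ

/-- The nonlocal seminorm `(∫ ∫ |f(x+h) - f(x)|ᵖ dx μ(dh))^(1/p)`, possibly infinite. -/
noncomputable def nonlocalSeminorm {d : ℕ} (p : ℝ) (μ : Measure (EuclideanSpace ℝ (Fin d)))
    (f : EuclideanSpace ℝ (Fin d) → ℝ) : ℝ≥0∞ :=
  (∫⁻ h, ∫⁻ x, ENNReal.ofReal (|f (x + h) - f x| ^ p) ∂volume ∂μ) ^ (1 / p)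

/-- The nonlocal Sobolev norm `‖f‖_p + [f]`, possibly infinite. -/
noncomputable def nonlocalSobolevNorm {d : ℕ} (p : ℝ) (μ : Measure (EuclideanSpace ℝ (Fin d)))
    (f : EuclideanSpace ℝ (Fin d) → ℝ) : ℝ≥0∞ :=
  eLpNorm f (ENNReal.ofReal p) volume + nonlocalSeminorm p μ f

/-- Membership in the nonlocal Sobolev space: Lebesgue measurable functions of finite norm. -/
def MemNonlocalSobolev {d : ℕ} (p : ℝ) (μ : Measure (EuclideanSpace ℝ (Fin d)))
    (f : EuclideanSpace ℝ (Fin d) → ℝ) : Prop :=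
  AEStronglyMeasurable f volume ∧ nonlocalSobolevNorm p μ f < ∞

/-! The proof rests on two estimates and an absorption. The index condition gives `ScalesBelow` with
some `b < d + 1`, hence `b < d + p` and `b < 2 * d`. For small `x` and `ρ = ‖x‖ / η`, scaling bounds
the density at each nonzero point of length at most `ρ` by its average over the annulus `ρ < ‖h‖ <
2ρ`. As `‖y‖ ^ (p - b)` is integrable at zero, the concentration function at `‖x‖` is at most a
constant times the mass of `{‖x‖ < η‖h‖, ‖h‖ < R}`, plus a constant (`exists_concentration_le`).

It remains to integrate `|f(x)|^p` against that mass. Splitting `f(x)` as `f(x+h) - (f(x+h) - f(x))`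
gives the seminorm plus a term in `|f(x+h)|^p`. After the shift `y = x + h`, the latter carries the
mass of `{‖y - h‖ < η‖h‖}`, a set inside a ball about `y` of radius `2η‖y‖`. By scaling this is at
most a multiple of `η ^ (2d - b)` times the original mass at `y`, plus a tail
(`measure_reachingIncrements_le`). For small `η` the term is absorbed on the left, which is
legitimate once `‖h‖ > δ` makes the left side finite; then `δ → 0`. -/

/-- `n` scales with exponent `-b` below the radius `R`. -/
def ScalesBelow {E : Type*} [NormedAddCommGroup E] (n : E → ℝ≥0∞) (C R b : ℝ) : Prop :=
  ∀ x h : E, 0 < ‖x‖ → ‖x‖ < ‖h‖ → ‖h‖ < R → n x ≤ ENNReal.ofReal (C * (‖h‖ / ‖x‖) ^ b) * n h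

theorem exists_scalesBelow {d : ℕ} {ν : EuclideanSpace ℝ (Fin d) → ℝ} {ν₀ : ℝ → ℝ}
    (hν_radial : ∀ x, x ≠ 0 → ν x = ν₀ ‖x‖)
    (hν_index : ((-(d : ℝ) - 1 : ℝ) : EReal) < lowerMatuszewskaIndexAtZero ν₀) :
    ∃ C R b : ℝ, 0 < C ∧ 0 < R ∧ 0 ≤ b ∧ b < d + 1 ∧
      ScalesBelow (fun x => ENNReal.ofReal (ν x)) C R b := by
  obtain ⟨_, ⟨a, ⟨A, R, hA, hR, hpos, hmul⟩, rfl⟩, ha⟩ := lt_sSup_iff.1 hν_index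
  have ha' : -(d : ℝ) - 1 < a := EReal.coe_lt_coe_iff.1 ha
  -- The ratio `‖h‖ / ‖x‖` exceeds 1, so raising the exponent to make it nonnegative only weakens
  -- the bound.
  refine ⟨A⁻¹, R, max (-a) 0, inv_pos.2 hA, hR, le_max_right _ _, ?_, ?_⟩
  · have : (0 : ℝ) ≤ d := Nat.cast_nonneg d
    exact max_lt (by linarith) (by linarith)
  · intro x h hx hxh hh
    have hx0 : x ≠ 0 := norm_pos_iff.1 hx
    have hh0 : h ≠ 0 := norm_pos_iff.1 (hx.trans hxh)
    have hc : 0 ≤ A⁻¹ * (‖h‖ / ‖x‖) ^ (max (-a) 0) := by positivity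
    simp only [hν_radial x hx0, hν_radial h hh0]
    rw [← ENNReal.ofReal_mul hc]
    apply ENNReal.ofReal_le_ofReal
    have h1 := hmul _ _ hx hxh hh
    have hx' := hpos _ hx (hxh.trans hh)
    have hh' := hpos _ (hx.trans hxh) hh
    have hq : 1 ≤ ‖h‖ / ‖x‖ := (one_le_div hx).2 hxh.le
    have hq0 : 0 < ‖h‖ / ‖x‖ := by linarith
    have h2 : (‖h‖ / ‖x‖) ^ (-a) ≤ (‖h‖ / ‖x‖) ^ (max (-a) 0) :=
      Real.rpow_le_rpow_of_exponent_le hq (le_max_left _ _)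
    rw [le_div_iff₀ hx'] at h1
    have h3 : ν₀ ‖x‖ = A⁻¹ * (‖h‖ / ‖x‖) ^ (-a) * (A * (‖h‖ / ‖x‖) ^ a * ν₀ ‖x‖) := by
      rw [Real.rpow_neg hq0.le]
      have := (Real.rpow_pos_of_pos hq0 a).ne'
      field_simp
    rw [h3]
    gcongr

/-! ### Integrals of powers of the norm over balls. -/

theorem lintegral_comp_smul_addHaar {E : Type*} [NormedAddCommGroup E] [NormedSpace ℝ E]
    [MeasurableSpace E] [BorelSpace E] [FiniteDimensional ℝ E] (μ : Measure E)
    [μ.IsAddHaarMeasure] (F : E → ℝ≥0∞) {r : ℝ} (hr : r ≠ 0) :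
    ∫⁻ x, F (r • x) ∂μ = ENNReal.ofReal |(r ^ Module.finrank ℝ E)⁻¹| * ∫⁻ x, F x ∂μ := by
  have := (Homeomorph.smulOfNeZero r hr).measurableEmbedding.lintegral_map (μ := μ) F
  simp only [Homeomorph.smulOfNeZero_apply] at this
  rw [← this]
  erw [Measure.map_addHaar_smul μ hr]
  rw [lintegral_smul_measure, smul_eq_mul]

theorem setLIntegral_norm_rpow_ball_one_lt_top {d : ℕ} (hd : 1 ≤ d) {s : ℝ} (hs : -(d : ℝ) < s) :
    ∫⁻ x in Metric.ball (0 : EuclideanSpace ℝ (Fin d)) 1, ENNReal.ofReal (‖x‖ ^ s) < ∞ := by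
  have : Nonempty (Fin d) := ⟨⟨0, hd⟩⟩
  have h : IntegrableOn (fun x : EuclideanSpace ℝ (Fin d) => ‖x‖ ^ s) (Metric.ball 0 1) := by
    rw [integrableOn_fun_norm_addHaar volume (f := fun y => y ^ s)]
    have h1 : IntegrableOn (fun y : ℝ => y ^ (s + (d - 1))) (Set.Ioo 0 1) := by
      rw [intervalIntegral.integrableOn_Ioo_rpow_iff one_pos]
      linarith
    refine h1.congr_fun (fun y hy => ?_) measurableSet_Ioo
    simp only [finrank_euclideanSpace, Fintype.card_fin, smul_eq_mul]
    rw [Real.rpow_add hy.1, mul_comm, ← Real.rpow_natCast, Nat.cast_sub hd, Nat.cast_one]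
  exact h.lintegral_lt_top

theorem setLIntegral_norm_div_rpow_ball {d : ℕ} {ρ : ℝ} (hρ : 0 < ρ) (s : ℝ) :
    ∫⁻ x in Metric.ball (0 : EuclideanSpace ℝ (Fin d)) ρ, ENNReal.ofReal ((‖x‖ / ρ) ^ s) =
      ENNReal.ofReal (ρ ^ d) *
        ∫⁻ x in Metric.ball (0 : EuclideanSpace ℝ (Fin d)) 1, ENNReal.ofReal (‖x‖ ^ s) := by
  have h := lintegral_comp_smul_addHaar (volume : Measure (EuclideanSpace ℝ (Fin d)))
    ((Metric.ball 0 1).indicator fun x => ENNReal.ofReal (‖x‖ ^ s)) (inv_pos.2 hρ).ne'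
  rw [← lintegral_indicator Metric.isOpen_ball.measurableSet,
    ← lintegral_indicator Metric.isOpen_ball.measurableSet]
  convert h using 2
  · funext x
    have h1 : ‖ρ⁻¹ • x‖ = ‖x‖ / ρ := by
      rw [norm_smul, norm_inv, Real.norm_of_nonneg hρ.le, div_eq_inv_mul]
    simp only [Set.indicator, mem_ball_zero_iff, h1, div_lt_one hρ]
  · rw [finrank_euclideanSpace, Fintype.card_fin, inv_pow, inv_inv, abs_of_pos (by positivity)]

/-! ### Comparing the density at a point with the mass of an annulus. -/

section annulus

variable {d : ℕ} {n : EuclideanSpace ℝ (Fin d) → ℝ≥0∞} {C R b : ℝ}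

/-- The open annulus of radii `ρ` and `2 ρ`. -/
def annulus (d : ℕ) (ρ : ℝ) : Set (EuclideanSpace ℝ (Fin d)) := {h | ρ < ‖h‖ ∧ ‖h‖ < 2 * ρ}

theorem measurableSet_annulus (ρ : ℝ) : MeasurableSet (annulus d ρ) := by
  unfold annulus; measurability

theorem volume_annulus_ge (hd : 1 ≤ d) {ρ : ℝ} (hρ : 0 < ρ) :
    ENNReal.ofReal (ρ ^ d) * volume (Metric.ball (0 : EuclideanSpace ℝ (Fin d)) 1) ≤
      volume (annulus d ρ) := by
  have hsub : Metric.ball (0 : EuclideanSpace ℝ (Fin d)) (2 * ρ) ⊆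
      annulus d ρ ∪ Metric.closedBall 0 ρ := by
    intro x hx
    rw [mem_ball_zero_iff] at hx
    rcases le_or_gt ‖x‖ ρ with h | h
    · exact Or.inr (mem_closedBall_zero_iff.2 h)
    · exact Or.inl ⟨h, hx⟩
  have h := (measure_mono (μ := volume) hsub).trans (measure_union_le _ _)
  rw [Measure.addHaar_ball_of_pos _ _ (by positivity), Measure.addHaar_closedBall _ _ hρ.le,
    finrank_euclideanSpace, Fintype.card_fin] at h
  set v := volume (Metric.ball (0 : EuclideanSpace ℝ (Fin d)) 1)
  have hfin : ENNReal.ofReal (ρ ^ d) * v ≠ ∞ :=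
    ENNReal.mul_ne_top ENNReal.ofReal_ne_top measure_ball_lt_top.ne
  refine (ENNReal.add_le_add_iff_right hfin).1 (le_trans ?_ h)
  rw [← add_mul, ← ENNReal.ofReal_add (by positivity) (by positivity), mul_pow]
  gcongr
  have : (2 : ℝ) ≤ 2 ^ d := by simpa using pow_le_pow_right₀ (one_le_two (α := ℝ)) hd
  nlinarith [pow_pos hρ d]

/-- Scaling compares `n x` with every `n h` in the annulus; integrating in `h` turns a pointwise
value into a mass. -/
theorem ScalesBelow.mul_le_annulus (hS : ScalesBelow n C R b) (hd : 1 ≤ d) (hC : 0 ≤ C)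
    (hb : 0 ≤ b) {ρ : ℝ} (hρR : 2 * ρ ≤ R) {x : EuclideanSpace ℝ (Fin d)} (hx : 0 < ‖x‖)
    (hxρ : ‖x‖ ≤ ρ) :
    n x * (ENNReal.ofReal (ρ ^ d) * volume (Metric.ball (0 : EuclideanSpace ℝ (Fin d)) 1)) ≤
      ENNReal.ofReal (C * (2 * ρ / ‖x‖) ^ b) * volume.withDensity n (annulus d ρ) := by
  have hρ : 0 < ρ := hx.trans_le hxρ
  calc _ ≤ n x * volume (annulus d ρ) := by gcongr; exact volume_annulus_ge hd hρ
    _ = ∫⁻ _ in annulus d ρ, n x := by rw [setLIntegral_const]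
    _ ≤ ∫⁻ h in annulus d ρ, ENNReal.ofReal (C * (2 * ρ / ‖x‖) ^ b) * n h := by
      refine setLIntegral_mono' (measurableSet_annulus ρ) fun h hh => ?_
      refine (hS x h hx (hxρ.trans_lt hh.1) (hh.2.trans_le hρR)).trans ?_
      have := hh.2.le
      gcongr
    _ = _ := by
      rw [lintegral_const_mul' _ _ ENNReal.ofReal_ne_top,
        withDensity_apply _ (measurableSet_annulus ρ)]

end annulus

/-! ### Mass of the increment sets and the concentration function. -/

section kernels

variable {d : ℕ} {n : EuclideanSpace ℝ (Fin d) → ℝ≥0∞} {C R b η δ p : ℝ}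

/-- The increments `h`, of length between `δ` and `R`, with `‖x‖ < η ‖h‖`. -/
def increments (η δ R : ℝ) (x : EuclideanSpace ℝ (Fin d)) : Set (EuclideanSpace ℝ (Fin d)) :=
  {h | (δ < ‖h‖ ∧ ‖h‖ < R) ∧ ‖x‖ < η * ‖h‖}

/-- The increments `h`, of length between `δ` and `R`, with `‖x - h‖ < η ‖h‖`. -/
def reachingIncrements (η δ R : ℝ) (x : EuclideanSpace ℝ (Fin d)) :
    Set (EuclideanSpace ℝ (Fin d)) :=
  {h | (δ < ‖h‖ ∧ ‖h‖ < R) ∧ ‖x - h‖ < η * ‖h‖}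

theorem measurableSet_increments (x : EuclideanSpace ℝ (Fin d)) :
    MeasurableSet (increments η δ R x) := by
  unfold increments; measurability

theorem measurableSet_reachingIncrements (x : EuclideanSpace ℝ (Fin d)) :
    MeasurableSet (reachingIncrements η δ R x) := by
  unfold reachingIncrements
  exact (by measurability : MeasurableSet {h : EuclideanSpace ℝ (Fin d) | δ < ‖h‖ ∧ ‖h‖ < R}).inter
    (measurableSet_lt (f := fun h => ‖x - h‖) (g := fun h => η * ‖h‖) (by fun_prop) (by fun_prop))

theorem norm_bounds_of_mem_reachingIncrements (hη : η ≤ 1 / 2)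
    {x h : EuclideanSpace ℝ (Fin d)} (hh : h ∈ reachingIncrements η δ R x) :
    ‖h‖ ≤ 2 * ‖x‖ ∧ 2 * ‖x‖ ≤ 3 * ‖h‖ := by
  have h1 := hh.2
  have h2 := norm_sub_norm_le h x
  have h3 := norm_sub_norm_le x h
  rw [norm_sub_rev] at h2
  have h4 : η * ‖h‖ ≤ 1 / 2 * ‖h‖ := by gcongr
  constructor <;> linarith

/-- The volume factor `(2η²)^d` is that of a ball of radius `2η‖x‖ = 2η²ρ` relative to one of radius
`ρ = ‖x‖ / η`; the density there costs at most `C (3/η)^b` relative to its average over the annulus.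
-/
theorem measure_reachingIncrements_le_of_scales (hS : ScalesBelow n C R b) (hd : 1 ≤ d)
    (hC : 0 ≤ C) (hb : 0 ≤ b) (hη0 : 0 < η) (hη : η ≤ 1 / 2)
    {x : EuclideanSpace ℝ (Fin d)} (hxR : 2 * ‖x‖ ≤ η * R) :
    volume.withDensity n (reachingIncrements η δ R x) ≤
      ENNReal.ofReal ((2 * η ^ 2) ^ d * (C * (3 / η) ^ b)) *
        volume.withDensity n (increments η δ R x) := by
  set ρ := ‖x‖ / η with hρdef
  have hxρ : ‖x‖ = η * ρ := by rw [hρdef]; field_simp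
  rcases Set.eq_empty_or_nonempty (reachingIncrements η δ R x) with he | ⟨h₀, hh₀⟩
  · rw [he]; simp
  have hx : 0 < ‖x‖ := by
    rcases (norm_nonneg x).eq_or_lt with h0 | h0
    · have := hh₀.2
      rw [norm_eq_zero.1 h0.symm, zero_sub, norm_neg] at this
      nlinarith [norm_nonneg h₀]
    · exact h0
  have hρ : 0 < ρ := div_pos hx hη0
  have hρR : 2 * ρ ≤ R := by
    rw [hxρ] at hxR
    nlinarith
  have h2x : 2 * ‖x‖ ≤ ρ := by rw [hxρ]; nlinarith
  -- An element `h₀` of the left-hand set forces `δ < ‖h₀‖ ≤ 2‖x‖ ≤ ρ`, so the annulus survives the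
  -- truncation.
  have hδ : δ < ρ :=
    (hh₀.1.1.trans_le (norm_bounds_of_mem_reachingIncrements hη hh₀).1).trans_le h2x
  have hann : annulus d ρ ⊆ increments η δ R x := fun h hh =>
    ⟨⟨hδ.trans hh.1, hh.2.trans_le hρR⟩, by rw [hxρ]; exact mul_lt_mul_of_pos_left hh.1 hη0⟩
  set v := volume (Metric.ball (0 : EuclideanSpace ℝ (Fin d)) 1) with hv
  set W := ENNReal.ofReal (ρ ^ d) * v with hW
  have hW0 : W ≠ 0 := mul_ne_zero (by simpa using pow_pos hρ d)
    (Metric.measure_ball_pos _ _ one_pos).ne'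
  have hWt : W ≠ ∞ := ENNReal.mul_ne_top ENNReal.ofReal_ne_top measure_ball_lt_top.ne
  have hvol : volume (reachingIncrements η δ R x) ≤ ENNReal.ofReal ((2 * η ^ 2) ^ d) * W := by
    calc _ ≤ volume (Metric.ball x (2 * η ^ 2 * ρ)) := by
          refine measure_mono fun h hh => ?_
          rw [Metric.mem_ball, dist_comm, dist_eq_norm]
          have h1 := (norm_bounds_of_mem_reachingIncrements hη hh).1
          have h2 := hh.2
          rw [hxρ] at h1
          nlinarith
      _ = _ := by
        rw [Measure.addHaar_ball_of_pos _ _ (by positivity), finrank_euclideanSpace,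
          Fintype.card_fin, hW, ← mul_assoc, ← ENNReal.ofReal_mul (by positivity), mul_pow _ ρ]
  -- Multiplying through by `W`, the volume of a ball of radius `ρ`, avoids dividing in
  -- `mul_le_annulus`.
  refine (ENNReal.mul_le_mul_iff_left hW0 hWt).1 ?_
  calc _ = ∫⁻ h in reachingIncrements η δ R x, n h * W := by
        rw [withDensity_apply _ (measurableSet_reachingIncrements x), lintegral_mul_const' _ _ hWt]
    _ ≤ ∫⁻ h in reachingIncrements η δ R x,
          ENNReal.ofReal (C * (3 / η) ^ b) * volume.withDensity n (increments η δ R x) := by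
      refine setLIntegral_mono' (measurableSet_reachingIncrements x) fun h hh => ?_
      have hb' := norm_bounds_of_mem_reachingIncrements hη hh
      have hh0 : 0 < ‖h‖ := by linarith
      refine (hS.mul_le_annulus hd hC hb hρR hh0 (hb'.1.trans h2x)).trans ?_
      have : 2 * ρ / ‖h‖ ≤ 3 / η := by
        rw [div_le_div_iff₀ hh0 hη0]
        linarith [hb'.2, hxρ]
      gcongr
    _ = ENNReal.ofReal (C * (3 / η) ^ b) * volume.withDensity n (increments η δ R x) *
          volume (reachingIncrements η δ R x) := by rw [setLIntegral_const]
    _ ≤ ENNReal.ofReal (C * (3 / η) ^ b) * volume.withDensity n (increments η δ R x) *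
          (ENNReal.ofReal ((2 * η ^ 2) ^ d) * W) := by gcongr
    _ = _ := by
      rw [ENNReal.ofReal_mul (by positivity : (0 : ℝ) ≤ (2 * η ^ 2) ^ d)]
      rw [← mul_assoc]
      congr 1
      rw [mul_comm, ← mul_assoc]

theorem measure_reachingIncrements_le (hS : ScalesBelow n C R b) (hd : 1 ≤ d)
    (hC : 0 ≤ C) (hb : 0 ≤ b) (hη0 : 0 < η) (hη : η ≤ 1 / 2)
    (x : EuclideanSpace ℝ (Fin d)) :
    volume.withDensity n (reachingIncrements η δ R x) ≤
      ENNReal.ofReal ((2 * η ^ 2) ^ d * (C * (3 / η) ^ b)) *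
        volume.withDensity n (increments η δ R x) +
      volume.withDensity n {h | η * R / 3 ≤ ‖h‖} := by
  rcases le_or_gt (2 * ‖x‖) (η * R) with h | h
  · exact (measure_reachingIncrements_le_of_scales hS hd hC hb hη0 hη h).trans le_self_add
  · refine le_trans (measure_mono fun y hy => ?_) le_add_self
    have := (norm_bounds_of_mem_reachingIncrements hη hy).2
    exact show η * R / 3 ≤ ‖y‖ by linarith

variable {μ : Measure (EuclideanSpace ℝ (Fin d))}

theorem measure_norm_ge_le_concentration (hp : 0 < p) {r : ℝ} (hr : 0 < r) :
    μ {h | r ≤ ‖h‖} ≤ concentration p μ r := by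
  have hm : MeasurableSet {h : EuclideanSpace ℝ (Fin d) | r ≤ ‖h‖} := by measurability
  rw [← lintegral_indicator_one hm]
  refine lintegral_mono (Set.indicator_le' (fun y hy => ?_) (fun _ _ => zero_le))
  have : r ^ p ≤ ‖y‖ ^ p := Real.rpow_le_rpow hr.le (show r ≤ ‖y‖ from hy) hp.le
  rw [min_eq_left ((one_le_div (Real.rpow_pos_of_pos hr p)).2 this)]
  simp

theorem IsPIntegrable.concentration_lt_top (h : IsPIntegrable p μ) {r : ℝ} (hr : 0 < r) :
    concentration p μ r < ∞ := by
  have hrp := Real.rpow_pos_of_pos hr p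
  calc concentration p μ r
      ≤ ∫⁻ x, ENNReal.ofReal (1 + (r ^ p)⁻¹) * ENNReal.ofReal (min 1 (‖x‖ ^ p)) ∂μ := by
        refine lintegral_mono fun x => ?_
        rw [← ENNReal.ofReal_mul (by positivity)]
        apply ENNReal.ofReal_le_ofReal
        have hx : 0 ≤ ‖x‖ ^ p := by positivity
        have hi : 0 < (r ^ p)⁻¹ := by positivity
        rw [div_eq_mul_inv]
        rcases le_total 1 (‖x‖ ^ p) with h1 | h1
        · rw [min_eq_left h1]
          exact (min_le_left _ _).trans (by linarith)
        · rw [min_eq_right h1]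
          exact (min_le_right _ _).trans (by nlinarith)
    _ = ENNReal.ofReal (1 + (r ^ p)⁻¹) * ∫⁻ x, ENNReal.ofReal (min 1 (‖x‖ ^ p)) ∂μ :=
        lintegral_const_mul' _ _ ENNReal.ofReal_ne_top
    _ < ∞ := ENNReal.mul_lt_top ENNReal.ofReal_lt_top h

theorem concentration_anti (hp : 0 ≤ p) {r s : ℝ} (hr : 0 < r) (hrs : r ≤ s) :
    concentration p μ s ≤ concentration p μ r := by
  refine lintegral_mono fun x => ENNReal.ofReal_le_ofReal ?_
  gcongr

theorem setLIntegral_norm_rpow_closedBall_le (hn : AEMeasurable n volume)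
    (hS : ScalesBelow n C R b) (hd : 1 ≤ d)
    (hC : 0 ≤ C) (hb : 0 ≤ b) (hp : 0 < p) (hη0 : 0 < η)
    {x : EuclideanSpace ℝ (Fin d)} (hx : 0 < ‖x‖) (hxR : 2 * ‖x‖ ≤ η * R) :
    ∫⁻ y in Metric.closedBall 0 (‖x‖ / η), ENNReal.ofReal (‖y‖ ^ p / ‖x‖ ^ p)
        ∂(volume.withDensity n) ≤
      ENNReal.ofReal (C * (2 / η) ^ p * 2 ^ d) *
        (∫⁻ z in Metric.ball (0 : EuclideanSpace ℝ (Fin d)) 1, ENNReal.ofReal (‖z‖ ^ (p - b))) *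
        (volume (Metric.ball (0 : EuclideanSpace ℝ (Fin d)) 1))⁻¹ *
        volume.withDensity n (increments η 0 R x) := by
  set ρ := ‖x‖ / η with hρdef
  have hxρ : ‖x‖ = η * ρ := by rw [hρdef]; field_simp
  have hρ : 0 < ρ := div_pos hx hη0
  have hρR : 2 * ρ ≤ R := by
    rw [hxρ] at hxR
    nlinarith
  have hann : annulus d ρ ⊆ increments η 0 R x := fun h hh =>
    ⟨⟨hρ.trans hh.1, hh.2.trans_le hρR⟩, by rw [hxρ]; exact mul_lt_mul_of_pos_left hh.1 hη0⟩
  set v := volume (Metric.ball (0 : EuclideanSpace ℝ (Fin d)) 1) with hv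
  have hv0 : v ≠ 0 := (Metric.measure_ball_pos _ _ one_pos).ne'
  have hvt : v ≠ ∞ := measure_ball_lt_top.ne
  set W := ENNReal.ofReal (ρ ^ d) * v with hW
  have hW0 : W ≠ 0 := mul_ne_zero (by simpa using pow_pos hρ d) hv0
  have hWt : W ≠ ∞ := ENNReal.mul_ne_top ENNReal.ofReal_ne_top measure_ball_lt_top.ne
  set V := volume.withDensity n (increments η 0 R x)
  refine (ENNReal.mul_le_mul_iff_left hW0 hWt).1 ?_
  rw [setLIntegral_withDensity_eq_lintegral_mul₀ hn (by fun_prop)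
    Metric.isClosed_closedBall.measurableSet, ← lintegral_mul_const' _ _ hWt]
  calc _ ≤ ∫⁻ y in Metric.closedBall (0 : EuclideanSpace ℝ (Fin d)) ρ,
          ENNReal.ofReal (C * (2 / η) ^ p) * V *
            ENNReal.ofReal ((‖y‖ / (2 * ρ)) ^ (p - b)) := by
        refine setLIntegral_mono' Metric.isClosed_closedBall.measurableSet fun y hy => ?_
        rw [mem_closedBall_zero_iff] at hy
        -- Scaling says nothing at the origin, but the weight vanishes there because `p > 0`.
        rcases (norm_nonneg y).eq_or_lt with h0 | h0
        · simp [← h0, Real.zero_rpow hp.ne']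
        calc _ = ENNReal.ofReal (‖y‖ ^ p / ‖x‖ ^ p) * (n y * W) := by
              simp only [Pi.mul_apply]; ring
          _ ≤ ENNReal.ofReal (‖y‖ ^ p / ‖x‖ ^ p) * (ENNReal.ofReal (C * (2 * ρ / ‖y‖) ^ b) * V) := by
              refine mul_le_mul_right ?_ _
              exact (hS.mul_le_annulus hd hC hb hρR h0 hy).trans (by gcongr; exact measure_mono hann)
          _ = _ := by
              rw [mul_right_comm, ← mul_assoc, ← ENNReal.ofReal_mul (by positivity),
                ← ENNReal.ofReal_mul (by positivity)]
              congr 2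
              have e1 : ‖y‖ ^ p / ‖x‖ ^ p = (2 / η) ^ p * (‖y‖ / (2 * ρ)) ^ p := by
                rw [← Real.div_rpow h0.le hx.le, ← Real.mul_rpow (by positivity) (by positivity),
                  hxρ]
                congr 1
                field_simp
              have e2 : (2 * ρ / ‖y‖) ^ b = ((‖y‖ / (2 * ρ)) ^ b)⁻¹ := by
                rw [← Real.inv_rpow (by positivity), inv_div]
              rw [e1, e2, Real.rpow_sub (by positivity)]
              ring
    _ ≤ ∫⁻ y in Metric.ball (0 : EuclideanSpace ℝ (Fin d)) (2 * ρ),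
          ENNReal.ofReal (C * (2 / η) ^ p) * V *
            ENNReal.ofReal ((‖y‖ / (2 * ρ)) ^ (p - b)) :=
        lintegral_mono_set (Metric.closedBall_subset_ball (by linarith))
    _ = ENNReal.ofReal (C * (2 / η) ^ p) * V * (ENNReal.ofReal ((2 * ρ) ^ d) *
          ∫⁻ z in Metric.ball (0 : EuclideanSpace ℝ (Fin d)) 1,
            ENNReal.ofReal (‖z‖ ^ (p - b))) := by
        rw [lintegral_const_mul _ (by fun_prop), setLIntegral_norm_div_rpow_ball (by positivity)]
    _ = _ := by
        have hvv : v⁻¹ * v = 1 := ENNReal.inv_mul_cancel hv0 hvt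
        rw [mul_pow, ENNReal.ofReal_mul (by positivity : (0:ℝ) ≤ 2 ^ d),
          ENNReal.ofReal_mul (by positivity : (0:ℝ) ≤ C * (2 / η) ^ p), hW]
        generalize ENNReal.ofReal (C * (2 / η) ^ p) = c₁
        generalize ENNReal.ofReal (2 ^ d) = c₂
        generalize ENNReal.ofReal (ρ ^ d) = c₃
        generalize ∫⁻ z in Metric.ball (0 : EuclideanSpace ℝ (Fin d)) 1,
          ENNReal.ofReal (‖z‖ ^ (p - b)) = L
        calc _ = c₁ * c₂ * L * V * c₃ * 1 := by ring
          _ = c₁ * c₂ * L * V * c₃ * (v⁻¹ * v) := by rw [hvv]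
          _ = _ := by ring

/-- Three regions cover the space: `‖y‖ ≥ R`, `‖y‖ ≤ ‖x‖ / η`, and the increments between. On the
first and last the integrand is at most 1. -/
theorem concentration_le_of_small (hn : AEMeasurable n volume)
    (hS : ScalesBelow n C R b) (hd : 1 ≤ d)
    (hC : 0 ≤ C) (hb : 0 ≤ b) (hp : 0 < p) (hη0 : 0 < η)
    {x : EuclideanSpace ℝ (Fin d)} (hx : 0 < ‖x‖) (hxR : 2 * ‖x‖ ≤ η * R) :
    concentration p (volume.withDensity n) ‖x‖ ≤
      (ENNReal.ofReal (C * (2 / η) ^ p * 2 ^ d) *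
        (∫⁻ z in Metric.ball (0 : EuclideanSpace ℝ (Fin d)) 1, ENNReal.ofReal (‖z‖ ^ (p - b))) *
        (volume (Metric.ball (0 : EuclideanSpace ℝ (Fin d)) 1))⁻¹ + 1) *
        volume.withDensity n (increments η 0 R x) + volume.withDensity n {h | R ≤ ‖h‖} := by
  rw [add_mul, one_mul]
  refine le_trans ?_ (add_le_add (add_le_add
    (setLIntegral_norm_rpow_closedBall_le hn hS hd hC hb hp hη0 hx hxR) le_rfl) le_rfl)
  have hm : MeasurableSet {h : EuclideanSpace ℝ (Fin d) | R ≤ ‖h‖} := by measurability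
  have hm' : MeasurableSet (increments η 0 R x) := measurableSet_increments x
  have hmb := Metric.isClosed_closedBall (x := (0 : EuclideanSpace ℝ (Fin d)))
    (ε := ‖x‖ / η).measurableSet
  rw [← lintegral_indicator hmb, ← lintegral_indicator_one hm, ← lintegral_indicator_one hm',
    ← lintegral_add_right _ (measurable_one.indicator hm'),
    ← lintegral_add_right _ (measurable_one.indicator hm)]
  refine lintegral_mono fun y => ?_
  rcases le_or_gt R ‖y‖ with h1 | h1
  · refine le_trans ?_ le_add_self
    rw [Set.indicator_of_mem (show y ∈ {h | R ≤ ‖h‖} from h1)]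
    simp
  rcases le_or_gt ‖y‖ (‖x‖ / η) with h2 | h2
  · refine le_trans ?_ (le_self_add.trans le_self_add)
    rw [Set.indicator_of_mem (mem_closedBall_zero_iff.2 h2)]
    exact ENNReal.ofReal_le_ofReal (min_le_right _ _)
  · refine le_trans ?_ (le_add_self.trans le_self_add)
    have h3 : ‖x‖ < η * ‖y‖ := by rwa [div_lt_iff₀' hη0] at h2
    rw [Set.indicator_of_mem (show y ∈ increments η 0 R x from
      ⟨⟨(div_pos hx hη0).trans h2, h1⟩, h3⟩)]
    simp

theorem exists_concentration_le (hn : AEMeasurable n volume)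
    (hS : ScalesBelow n C R b) (hd : 1 ≤ d)
    (hC : 0 ≤ C) (hR : 0 < R) (hb : 0 ≤ b) (hp : 0 < p) (hbp : b < d + p) (hη0 : 0 < η)
    (hint : IsPIntegrable p (volume.withDensity n)) :
    ∃ K : ℝ≥0∞, K ≠ ∞ ∧ ∀ x : EuclideanSpace ℝ (Fin d), 0 < ‖x‖ →
      concentration p (volume.withDensity n) ‖x‖ ≤
        K * volume.withDensity n (increments η 0 R x) + K := by
  set K₁ := ENNReal.ofReal (C * (2 / η) ^ p * 2 ^ d) *
        (∫⁻ z in Metric.ball (0 : EuclideanSpace ℝ (Fin d)) 1, ENNReal.ofReal (‖z‖ ^ (p - b))) *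
        (volume (Metric.ball (0 : EuclideanSpace ℝ (Fin d)) 1))⁻¹ + 1 with hK₁
  have hK₁t : K₁ ≠ ∞ := by
    refine ENNReal.add_ne_top.2 ⟨ENNReal.mul_ne_top (ENNReal.mul_ne_top ENNReal.ofReal_ne_top
      (setLIntegral_norm_rpow_ball_one_lt_top hd (by linarith)).ne) ?_, ENNReal.one_ne_top⟩
    exact ENNReal.inv_ne_top.2 (Metric.measure_ball_pos _ _ one_pos).ne'
  have hηR : 0 < η * R / 2 := by positivity
  have hR' := (measure_norm_ge_le_concentration (μ := volume.withDensity n) hp hR).trans_lt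
    (hint.concentration_lt_top hR)
  have hc := hint.concentration_lt_top hηR
  refine ⟨K₁ + volume.withDensity n {h | R ≤ ‖h‖} +
    concentration p (volume.withDensity n) (η * R / 2),
    ENNReal.add_ne_top.2 ⟨ENNReal.add_ne_top.2 ⟨hK₁t, hR'.ne⟩, hc.ne⟩, fun x hx => ?_⟩
  rcases le_or_gt (2 * ‖x‖) (η * R) with h | h
  · refine (concentration_le_of_small hn hS hd hC hb hp hη0 hx h).trans ?_
    refine add_le_add (mul_le_mul_left ?_ _) (le_add_self.trans le_self_add)
    exact le_self_add.trans le_self_add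
  · refine (concentration_anti hp.le hηR (by linarith)).trans ?_
    exact le_add_self.trans le_add_self

end kernels

/-! ### Tonelli on slices, the shift by an increment, and removal of the truncation. -/

theorem lintegral_setLIntegral_section {α β : Type*} [MeasurableSpace α] [MeasurableSpace β]
    {μ : Measure α} {ν : Measure β} [SFinite μ] [SFinite ν] {S : Set (α × β)}
    (hS : MeasurableSet S) {G : β → ℝ≥0∞} (hG : Measurable G) :
    ∫⁻ h, ∫⁻ x in {x | (h, x) ∈ S}, G x ∂ν ∂μ = ∫⁻ x, G x * μ {h | (h, x) ∈ S} ∂ν := by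
  have hF : Measurable (S.indicator fun q : α × β => G q.2) :=
    (hG.comp measurable_snd).indicator hS
  calc _ = ∫⁻ h, ∫⁻ x, S.indicator (fun q : α × β => G q.2) (h, x) ∂ν ∂μ := by
        refine lintegral_congr fun h => ?_
        exact (lintegral_indicator (measurable_prodMk_left hS) G).symm
    _ = ∫⁻ x, ∫⁻ h, S.indicator (fun q : α × β => G q.2) (h, x) ∂μ ∂ν :=
        lintegral_lintegral_swap hF.aemeasurable
    _ = _ := by
        refine lintegral_congr fun x => ?_
        rw [← setLIntegral_const]
        exact lintegral_indicator (measurable_prodMk_right hS) fun _ => G x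

section absorption

variable {d : ℕ} {μ : Measure (EuclideanSpace ℝ (Fin d))} {η δ R p : ℝ}

theorem measurableSet_lengths_prod :
    MeasurableSet {q : EuclideanSpace ℝ (Fin d) × EuclideanSpace ℝ (Fin d) |
      δ < ‖q.1‖ ∧ ‖q.1‖ < R} :=
  (measurableSet_lt measurable_const measurable_fst.norm).inter
    (measurableSet_lt measurable_fst.norm measurable_const)

theorem measurableSet_increments_prod :
    MeasurableSet {q : EuclideanSpace ℝ (Fin d) × EuclideanSpace ℝ (Fin d) |
      q.1 ∈ increments η δ R q.2} :=
  measurableSet_lengths_prod.inter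
    (measurableSet_lt measurable_snd.norm (measurable_fst.norm.const_mul η))

theorem measurableSet_reachingIncrements_prod :
    MeasurableSet {q : EuclideanSpace ℝ (Fin d) × EuclideanSpace ℝ (Fin d) |
      q.1 ∈ reachingIncrements η δ R q.2} :=
  measurableSet_lengths_prod.inter
    (measurableSet_lt (measurable_snd.sub measurable_fst).norm (measurable_fst.norm.const_mul η))

theorem lintegral_mul_measure_increments_le [SFinite μ] (hp : 1 ≤ p)
    {g : EuclideanSpace ℝ (Fin d) → ℝ} (hg : Measurable g) :
    ∫⁻ x, ‖g x‖ₑ ^ p * μ (increments η δ R x) ≤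
      2 ^ (p - 1) * ((∫⁻ h, ∫⁻ x, ‖g (x + h) - g x‖ₑ ^ p ∂volume ∂μ) +
        ∫⁻ x, ‖g x‖ₑ ^ p * μ (reachingIncrements η δ R x)) := by
  have hG : Measurable fun x => ‖g x‖ₑ ^ p := by fun_prop
  have h2 : (2 : ℝ≥0∞) ^ (p - 1) ≠ ∞ :=
    ENNReal.rpow_ne_top_of_nonneg (by linarith) ENNReal.ofNat_ne_top
  have e1 := lintegral_setLIntegral_section (μ := μ) (ν := volume)
    (measurableSet_increments_prod (d := d) (η := η) (δ := δ) (R := R)) hG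
  have e2 := lintegral_setLIntegral_section (μ := μ) (ν := volume)
    (measurableSet_reachingIncrements_prod (d := d) (η := η) (δ := δ) (R := R)) hG
  have hD : Measurable fun q : EuclideanSpace ℝ (Fin d) × EuclideanSpace ℝ (Fin d) =>
    ‖g (q.2 + q.1) - g q.2‖ₑ ^ p := by fun_prop
  refine e1.symm.le.trans ?_
  refine le_trans ?_ (mul_le_mul_right (add_le_add_right e2.le _) _)
  rw [← lintegral_add_left hD.lintegral_prod_right', ← lintegral_const_mul' _ _ h2]
  refine lintegral_mono fun h => ?_
  have hs : MeasurableSet {x | h ∈ increments η δ R x} :=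
    measurable_prodMk_left measurableSet_increments_prod
  have hs' : MeasurableSet {x | h ∈ reachingIncrements η δ R x} :=
    measurable_prodMk_left measurableSet_reachingIncrements_prod
  have hshift : ∫⁻ x in {x | h ∈ reachingIncrements η δ R x}, ‖g x‖ₑ ^ p =
      ∫⁻ x in {x | h ∈ increments η δ R x}, ‖g (x + h)‖ₑ ^ p := by
    rw [← lintegral_indicator hs', ← lintegral_indicator hs, ← lintegral_add_right_eq_self _ h]
    refine lintegral_congr fun x => ?_
    have : x + h ∈ {x | h ∈ reachingIncrements η δ R x} ↔ x ∈ {x | h ∈ increments η δ R x} := by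
      change (_ ∧ ‖x + h - h‖ < _) ↔ (_ ∧ _)
      rw [add_sub_cancel_right]
    by_cases hx : x ∈ {x | h ∈ increments η δ R x}
    · rw [Set.indicator_of_mem hx, Set.indicator_of_mem (this.2 hx)]
    · rw [Set.indicator_of_notMem hx, Set.indicator_of_notMem (mt this.1 hx)]
  calc ∫⁻ x in {x | h ∈ increments η δ R x}, ‖g x‖ₑ ^ p
      ≤ ∫⁻ x in {x | h ∈ increments η δ R x},
          2 ^ (p - 1) * (‖g (x + h) - g x‖ₑ ^ p + ‖g (x + h)‖ₑ ^ p) := by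
        refine lintegral_mono fun x => ?_
        refine le_trans ?_ (ENNReal.rpow_add_le_mul_rpow_add_rpow _ _ hp)
        gcongr
        rw [← enorm_neg (g (x + h) - g x)]
        refine le_trans (le_of_eq ?_) (enorm_add_le _ _)
        congr 1
        ring
    _ = 2 ^ (p - 1) * ((∫⁻ x in {x | h ∈ increments η δ R x}, ‖g (x + h) - g x‖ₑ ^ p) +
          ∫⁻ x in {x | h ∈ increments η δ R x}, ‖g (x + h)‖ₑ ^ p) := by
        rw [lintegral_const_mul' _ _ h2, lintegral_add_left (by fun_prop)]
    _ ≤ _ := by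
        refine mul_le_mul_right (add_le_add (setLIntegral_le_lintegral _ _) hshift.symm.le) _

theorem ENNReal.le_two_mul_of_le_add_half {a b : ℝ≥0∞} (ha : a ≠ ∞) (h : a ≤ b + a / 2) :
    a ≤ 2 * b := by
  have h2 : a / 2 ≠ ∞ := (ENNReal.div_lt_top ha two_ne_zero).ne
  nth_rw 1 [← ENNReal.add_halves a] at h
  have := (ENNReal.add_le_add_iff_right h2).1 h
  rw [ENNReal.div_le_iff two_ne_zero ENNReal.ofNat_ne_top] at this
  rwa [mul_comm]

/-- No limit of masses is needed: when `‖x‖ ≥ ηδ`, the condition `‖x‖ < η‖h‖` already forces `‖h‖ >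
δ`. Only the domain of `x` is exhausted, up to the null set `{0}`. -/
theorem lintegral_mul_measure_increments_zero_le [SFinite μ] (hd : 1 ≤ d) (hη : 0 < η)
    {G : EuclideanSpace ℝ (Fin d) → ℝ≥0∞} {B : ℝ≥0∞}
    (h : ∀ δ > 0, ∫⁻ x, G x * μ (increments η δ R x) ≤ B) :
    ∫⁻ x, G x * μ (increments η 0 R x) ≤ B := by
  have : Nonempty (Fin d) := ⟨⟨0, hd⟩⟩
  set A : ℕ → Set (EuclideanSpace ℝ (Fin d)) := fun k => {x | η * (1 / ((k : ℝ) + 1)) ≤ ‖x‖}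
  have hA : ∀ k, MeasurableSet (A k) := fun k => measurableSet_le (by fun_prop) (by fun_prop)
  have hmono : Monotone A := fun i j hij x hx => by
    have hx' : η * (1 / ((i : ℝ) + 1)) ≤ ‖x‖ := hx
    refine le_trans (b := η * (1 / ((i : ℝ) + 1))) ?_ hx'
    gcongr
  have hU : (⋃ k, A k) =ᵐ[volume] (Set.univ : Set (EuclideanSpace ℝ (Fin d))) := by
    rw [Filter.eventuallyEq_univ]
    filter_upwards [compl_mem_ae_iff.2
      (measure_singleton (μ := volume) (0 : EuclideanSpace ℝ (Fin d)))] with x hx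
    obtain ⟨k, hk⟩ := exists_nat_one_div_lt (div_pos (norm_pos_iff.2 hx) hη)
    refine Set.mem_iUnion.2 ⟨k, ?_⟩
    rw [lt_div_iff₀' hη] at hk
    exact hk.le
  rw [← setLIntegral_univ, ← setLIntegral_congr hU,
    setLIntegral_iUnion_of_directed _ hmono.directed_le]
  refine iSup_le fun k => ?_
  have hδ : 0 < 1 / ((k : ℝ) + 1) := by positivity
  refine le_trans ?_ (h _ hδ)
  refine (setLIntegral_mono' (hA k) fun x hx => ?_).trans (setLIntegral_le_lintegral _ _)
  have hx' : η * (1 / ((k : ℝ) + 1)) ≤ ‖x‖ := hx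
  refine mul_le_mul_right (measure_mono fun y hy => ?_) _
  exact ⟨⟨lt_of_mul_lt_mul_left (hx'.trans_lt hy.2) hη.le, hy.1.2⟩, hy.2⟩

end absorption

/-! ### Choice of `η`, absorption and conclusion. -/

theorem exists_small_ratio {d : ℕ} {b C ε : ℝ} (hb : b < 2 * d) (hε : 0 < ε) :
    ∃ η : ℝ, 0 < η ∧ η ≤ 1 / 2 ∧ (2 * η ^ 2) ^ d * (C * (3 / η) ^ b) ≤ ε := by
  have hs : 0 < 2 * d - b := by linarith
  have ht : Filter.Tendsto (fun η : ℝ => 2 ^ d * C * 3 ^ b * η ^ (2 * d - b))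
      (nhdsWithin 0 (Set.Ioi 0)) (nhds 0) := by
    have h1 : Filter.Tendsto (fun η : ℝ => 2 ^ d * C * 3 ^ b * η ^ (2 * d - b))
        (nhds 0) (nhds (2 ^ d * C * 3 ^ b * 0 ^ (2 * d - b))) :=
      ((Real.continuousAt_rpow_const 0 _ (Or.inr hs.le)).tendsto).const_mul _
    rw [Real.zero_rpow hs.ne', mul_zero] at h1
    exact h1.mono_left nhdsWithin_le_nhds
  have h2 : ∀ᶠ η : ℝ in nhdsWithin 0 (Set.Ioi 0), η < 1 / 2 :=
    nhdsWithin_le_nhds (Iio_mem_nhds (by norm_num))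
  obtain ⟨η, ⟨h3, h4⟩, h5⟩ := ((ht.eventually (gt_mem_nhds hε)).and h2).and
    self_mem_nhdsWithin |>.exists
  have hη : 0 < η := h5
  refine ⟨η, hη, h4.le, le_trans (le_of_eq ?_) h3.le⟩
  have e : η ^ (2 * d - b) = (η ^ 2) ^ d / η ^ b := by
    rw [Real.rpow_sub hη, ← pow_mul, ← Real.rpow_natCast]
    push_cast
    rfl
  rw [e, mul_pow, Real.div_rpow (by norm_num) hη.le]
  ring

theorem exists_lintegral_mul_measure_increments_le {d : ℕ} {n : EuclideanSpace ℝ (Fin d) → ℝ≥0∞}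
    {C R b p : ℝ} (hS : ScalesBelow n C R b) (hd : 1 ≤ d) (hC : 0 ≤ C) (hR : 0 < R) (hb : 0 ≤ b)
    (hbd : b < 2 * d) (hp : 1 ≤ p) (hint : IsPIntegrable p (volume.withDensity n)) :
    ∃ η : ℝ, 0 < η ∧ ∃ M : ℝ≥0∞, M ≠ ∞ ∧ ∀ g : EuclideanSpace ℝ (Fin d) → ℝ, Measurable g →
      ∫⁻ x, ‖g x‖ₑ ^ p ≠ ∞ →
      ∫⁻ x, ‖g x‖ₑ ^ p * volume.withDensity n (increments η 0 R x) ≤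
        M * ((∫⁻ h, ∫⁻ x, ‖g (x + h) - g x‖ₑ ^ p ∂volume ∂(volume.withDensity n)) +
          ∫⁻ x, ‖g x‖ₑ ^ p) := by
  have hp0 : 0 < p := by linarith
  obtain ⟨η, hη0, hη, hθ⟩ := exists_small_ratio (d := d) (C := C) (b := b)
    -- This value cancels the convexity constant `2 ^ (p - 1)` and leaves the factor 1/2 for the
    -- absorption.
    (ε := (2 ^ (p - 1) * 2)⁻¹) hbd (by positivity)
  set μ := volume.withDensity n with hμ
  set κ := μ {h | η * R / 3 ≤ ‖h‖} with hκ
  have htail : ∀ r > 0, μ {h | r ≤ ‖h‖} < ∞ := fun r hr =>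
    (measure_norm_ge_le_concentration hp0 hr).trans_lt (hint.concentration_lt_top hr)
  have hκt : κ ≠ ∞ := (htail _ (by positivity)).ne
  set c : ℝ≥0∞ := 2 ^ (p - 1) with hc
  have hct : c ≠ ∞ := ENNReal.rpow_ne_top_of_nonneg (by linarith) ENNReal.ofNat_ne_top
  set θ := ENNReal.ofReal ((2 * η ^ 2) ^ d * (C * (3 / η) ^ b)) with hθdef
  have hcθ : c * θ ≤ 2⁻¹ := by
    have hc' : c = ENNReal.ofReal (2 ^ (p - 1)) := by
      rw [← ENNReal.ofReal_rpow_of_pos two_pos, ENNReal.ofReal_ofNat]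
    calc c * θ ≤ ENNReal.ofReal (2 ^ (p - 1)) * ENNReal.ofReal ((2 ^ (p - 1) * 2)⁻¹) := by
          rw [hc']; exact mul_le_mul_right (ENNReal.ofReal_le_ofReal hθ) _
      _ = ENNReal.ofReal (2⁻¹) := by
          rw [← ENNReal.ofReal_mul (by positivity)]
          congr 1
          have : (0 : ℝ) < 2 ^ (p - 1) := by positivity
          field_simp
      _ = 2⁻¹ := by rw [ENNReal.ofReal_inv_of_pos two_pos, ENNReal.ofReal_ofNat]
  refine ⟨η, hη0, 2 * (c * (1 + κ)), by finiteness, fun g hg hN => ?_⟩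
  set D := ∫⁻ h, ∫⁻ x, ‖g (x + h) - g x‖ₑ ^ p ∂volume ∂μ
  set N := ∫⁻ x, ‖g x‖ₑ ^ p
  refine lintegral_mul_measure_increments_zero_le hd hη0 fun δ hδ => ?_
  set I := ∫⁻ x, ‖g x‖ₑ ^ p * μ (increments η δ R x) with hI
  -- The truncation is used here: the mass of `‖h‖ ≥ δ` is finite, so `I` may be subtracted.
  have hIt : I ≠ ∞ := by
    refine ((lintegral_mono fun x => mul_le_mul_right (measure_mono
      (t := {h | δ ≤ ‖h‖}) fun h hh => hh.1.1.le) _).trans_lt ?_).ne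
    rw [lintegral_mul_const' _ _ (htail δ hδ).ne]
    exact ENNReal.mul_lt_top hN.lt_top (htail δ hδ)
  have hθt : θ ≠ ∞ := ENNReal.ofReal_ne_top
  have hJ : ∫⁻ x, ‖g x‖ₑ ^ p * μ (reachingIncrements η δ R x) ≤ θ * I + κ * N := by
    calc _ ≤ ∫⁻ x, (θ * (‖g x‖ₑ ^ p * μ (increments η δ R x)) + κ * ‖g x‖ₑ ^ p) := by
          refine lintegral_mono fun x => ?_
          refine (mul_le_mul_right (measure_reachingIncrements_le hS hd hC hb hη0 hη x) _).trans
            (le_of_eq ?_)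
          rw [← hμ, ← hκ, ← hθdef]
          ring
      _ = _ := by
          rw [lintegral_add_right _ (by fun_prop), lintegral_const_mul' _ _ hθt,
            lintegral_const_mul' _ _ hκt]
  have hmain : I ≤ c * (D + κ * N) + I / 2 := by
    calc I ≤ c * (D + (θ * I + κ * N)) :=
          (lintegral_mul_measure_increments_le hp hg).trans (by gcongr)
      _ = c * (D + κ * N) + c * θ * I := by ring
      _ ≤ c * (D + κ * N) + 2⁻¹ * I := by gcongr
      _ = _ := by rw [div_eq_mul_inv, mul_comm I]
  refine (ENNReal.le_two_mul_of_le_add_half hIt hmain).trans ?_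
  -- The extra summand only completes the product `(1 + κ) * (D + N)`.
  calc 2 * (c * (D + κ * N)) ≤ 2 * (c * (D + κ * N)) + 2 * c * (κ * D + N) := le_self_add
    _ = _ := by ring

theorem theorem3p5 (d : ℕ) (hd : 1 ≤ d) (p : ℝ) (hp : 1 ≤ p)
    (ν : EuclideanSpace ℝ (Fin d) → ℝ) (ν₀ : ℝ → ℝ)
    (hν_meas : AEMeasurable ν volume)
    (hν_nonneg : ∀ x, 0 ≤ ν x)
    (hν_radial : ∀ x, x ≠ 0 → ν x = ν₀ ‖x‖)
    (hν_int : IsPIntegrable p (densityMeasure ν))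
    (hν_index : ((-(d : ℝ) - 1 : ℝ) : EReal) < lowerMatuszewskaIndexAtZero ν₀) :
    ∃ c : ℝ≥0, 0 < c ∧ ∀ f : EuclideanSpace ℝ (Fin d) → ℝ,
      MemNonlocalSobolev p (densityMeasure ν) f →
        ∫⁻ x, ENNReal.ofReal (|f x| ^ p) * concentration p (densityMeasure ν) ‖x‖ ∂volume ≤
          (c : ℝ≥0∞) * nonlocalSobolevNorm p (densityMeasure ν) f ^ p := by
  have : Nonempty (Fin d) := ⟨⟨0, hd⟩⟩
  have hp0 : 0 < p := by linarith
  have hd' : (1 : ℝ) ≤ d := by exact_mod_cast hd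
  obtain ⟨C, R, b, hC, hR, hb, hbd, hS⟩ := exists_scalesBelow hν_radial hν_index
  have hn : AEMeasurable (fun x => ENNReal.ofReal (ν x)) volume := hν_meas.ennreal_ofReal
  obtain ⟨η, hη, M, hM, hcore⟩ := exists_lintegral_mul_measure_increments_le hS hd hC.le hR hb
    (by linarith) hp hν_int
  obtain ⟨K, hK, hconc⟩ := exists_concentration_le hn hS hd hC.le hR hb hp0 (by linarith) hη hν_int
  have hKM : 2 * (K * M + K) ≠ ∞ := by finiteness
  refine ⟨(2 * (K * M + K)).toNNReal + 1, by positivity, fun f hf => ?_⟩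
  change _ ≤ _ * nonlocalSobolevNorm p (volume.withDensity fun x => ENNReal.ofReal (ν x)) f ^ p
  change MemNonlocalSobolev p (volume.withDensity fun x => ENNReal.ofReal (ν x)) f at hf
  change ∫⁻ x, _ * concentration p (volume.withDensity fun x => ENNReal.ofReal (ν x)) ‖x‖ ≤ _
  set μ := volume.withDensity fun x => ENNReal.ofReal (ν x) with hμ
  have habs : ∀ t : ℝ, ENNReal.ofReal (|t| ^ p) = ‖t‖ₑ ^ p := fun t => by
    rw [← ENNReal.ofReal_rpow_of_nonneg (abs_nonneg t) hp0.le, ← Real.norm_eq_abs, ofReal_norm]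
  set T := nonlocalSobolevNorm p μ f with hT
  -- Tonelli needs a Borel representative; for each fixed `h` the exceptional null set and its
  -- translate are both null, so the seminorm is unchanged.
  obtain ⟨g, hg, hfg⟩ := hf.1.aemeasurable
  have hNle : ∫⁻ x, ‖g x‖ₑ ^ p ≤ T ^ p := by
    calc ∫⁻ x, ‖g x‖ₑ ^ p = ∫⁻ x, ‖f x‖ₑ ^ p :=
          lintegral_congr_ae (by filter_upwards [hfg] with x hx; rw [hx])
      _ = eLpNorm f (ENNReal.ofReal p) volume ^ p := by
          rw [eLpNorm_eq_lintegral_rpow_enorm_toReal (by simpa using hp0) ENNReal.ofReal_ne_top,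
            ENNReal.toReal_ofReal hp0.le, ← ENNReal.rpow_mul, one_div_mul_cancel hp0.ne',
            ENNReal.rpow_one]
      _ ≤ T ^ p := ENNReal.rpow_le_rpow le_self_add hp0.le
  have hDle : ∫⁻ h, ∫⁻ x, ‖g (x + h) - g x‖ₑ ^ p ∂volume ∂μ ≤ T ^ p := by
    calc _ = ∫⁻ h, ∫⁻ x, ENNReal.ofReal (|f (x + h) - f x| ^ p) ∂volume ∂μ := by
          refine lintegral_congr fun h => lintegral_congr_ae ?_
          have hsh := (measurePreserving_add_right volume h).quasiMeasurePreserving.ae hfg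
          filter_upwards [hfg, hsh] with x hx hxh
          rw [habs, hx, hxh]
      _ = nonlocalSeminorm p μ f ^ p := by
          rw [nonlocalSeminorm, ← ENNReal.rpow_mul, one_div_mul_cancel hp0.ne', ENNReal.rpow_one]
      _ ≤ T ^ p := ENNReal.rpow_le_rpow le_add_self hp0.le
  have hTt : T ^ p < ∞ := ENNReal.rpow_lt_top_of_nonneg hp0.le hf.2.ne
  have hc := hcore g hg (hNle.trans_lt hTt).ne
  calc ∫⁻ x, ENNReal.ofReal (|f x| ^ p) * concentration p μ ‖x‖
      ≤ ∫⁻ x, (K * (‖g x‖ₑ ^ p * μ (increments η 0 R x)) + K * ‖g x‖ₑ ^ p) := by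
        refine lintegral_mono_ae ?_
        filter_upwards [hfg, compl_mem_ae_iff.2
          (measure_singleton (μ := volume) (0 : EuclideanSpace ℝ (Fin d)))] with x hx hx0
        rw [habs, hx]
        refine (mul_le_mul_right (hconc x (norm_pos_iff.2 hx0)) _).trans (le_of_eq ?_)
        ring
    _ = K * (∫⁻ x, ‖g x‖ₑ ^ p * μ (increments η 0 R x)) + K * ∫⁻ x, ‖g x‖ₑ ^ p := by
        rw [lintegral_add_right _ (by fun_prop), lintegral_const_mul' _ _ hK,
          lintegral_const_mul' _ _ hK]
    _ ≤ K * (M * (T ^ p + T ^ p)) + K * T ^ p := by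
        refine add_le_add (mul_le_mul_right (hc.trans ?_) _) (mul_le_mul_right hNle _)
        gcongr
    -- Slack matching the constant chosen above, whose `+ 1` ensures positivity.
    _ ≤ K * (M * (T ^ p + T ^ p)) + K * T ^ p + (K + 1) * T ^ p := le_self_add
    _ = (2 * (K * M + K) + 1) * T ^ p := by ring
    _ = _ := by rw [ENNReal.coe_add, ENNReal.coe_toNNReal hKM, ENNReal.coe_one]
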